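/- Let $G$ and $H$ be countable discrete groups and let $(\Omega,m)$ be a measure-equivalence coupling of them: a nonzero $\sigma$-finite measure space with commuting measurable $m$-preserving actions of $G$ and $H$, having measurable fundamental domains $Y$ for $G$ and $X$ for $H$ of finite measure (fundamental domains are understood up to null sets). Assume that $m$ is ergodic for $G\times H$, i.e. every measurable set invariant under both $G$ and $H$ is null or conull. Let $\alpha:G\times X\to H$ and $\beta:H\times Y\to G$ be the associated cocycles and $T:G\curvearrowright (X,m|_X)$, $S:H\curvearrowright (Y,m|_Y)$ the associated finite-measure-preserving actions, defined for almost every $x \in X$ and $y \in Y$ by $$g\cdot x=\alpha(g,x)^{-1}\cdot T^g x,\quad T^gx\in X,\qquad h\cdot y=\beta(h,y)^{-1}\cdot S^h y,\quad S^hy\in Y .$$ A measurable cocycle $\alpha$ over $T$ is called a measurable embedding with constant $C>0$ if there are a measurable map $\phi:X\to H$ and a measurable cocycle $\alpha':G\times X\to H$ over $T$ with $\alpha'(g,x)=\phi(T^gx)\,\alpha(g,x)\,\phi(x)^{-1}$ for every $g \in G$ and a.e. $x \in X$, such that for every $h\in H$ and a.e. $x\in X$, $$|\{g\in G:\alpha'(g,x)=h\}|\le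 C;$$ likewise for $\beta$ over $S$, with the roles of $G$ and $H$ exchanged. Theorem B.6 (thm:me-embedding). The maps $\alpha$ and $\beta$ are measurable cocycles over $T$ and $S$, and they are measurable embeddings; in fact the constant can be taken to be $\lceil m(X)/m(Y)\rceil$ for $\alpha$ and $\lceil m(Y)/m(X)\rceil$ for $\beta$. -/

import Mathlib

open MeasureTheory

section MeasurableEmbeddings

variable {G H Z : Type*} [Group G] [Group H] [MeasurableSpace Z]

/-- `T` is a finite-measure-preserving action of `G` on `(Z, μ)`, where, as usual in ergodic theory,
the identities of an action are required up to null sets. -/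
structure IsFMPAction (T : G → Z → Z) (μ : Measure Z) : Prop where
  isFiniteMeasure : IsFiniteMeasure μ
  measurePreserving : ∀ g, MeasurePreserving (T g) μ μ
  one_ae : ∀ᵐ z ∂μ, T 1 z = z
  mul_ae : ∀ g₁ g₂, ∀ᵐ z ∂μ, T (g₁ * g₂) z = T g₁ (T g₂ z)

/-- `α : G × Z → H` is a measurable cocycle over `T`. -/
structure IsMeasurableCocycle [MeasurableSpace G] [MeasurableSpace H]
    (T : G → Z → Z) (μ : Measure Z) (α : G → Z → H) : Prop where
  measurable : Measurable (Function.uncurry α)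
  mul_ae : ∀ g₂ g₁, ∀ᵐ z ∂μ, α (g₂ * g₁) z = α g₂ (T g₁ z) * α g₁ z

/-- `α'` and `α` are cohomologous over `T`, through a measurable transfer function `φ`. -/
def Cohomologous [MeasurableSpace H] (T : G → Z → Z) (μ : Measure Z) (α' α : G → Z → H) : Prop :=
  ∃ φ : Z → H, Measurable φ ∧ ∀ g, ∀ᵐ z ∂μ, α' g z = φ (T g z) * α g z * (φ z)⁻¹

/-- `T` is a finite-measure-preserving action, `α` is a measurable cocycle over it, and
`α` is a measurable embedding with constant `C`: it is cohomologous to a measurable cocycle `α'`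
for which almost every `α'(·, z) : G → H` is at most `C`-to-one. -/
structure IsMeasurableEmbeddingWith [MeasurableSpace G] [MeasurableSpace H] (C : ℕ)
    (T : G → Z → Z) (μ : Measure Z) (α : G → Z → H) : Prop where
  isFMPAction : IsFMPAction T μ
  isMeasurableCocycle : IsMeasurableCocycle T μ α
  pos : 0 < C
  exists_cohomologous : ∃ α' : G → Z → H, IsMeasurableCocycle T μ α' ∧ Cohomologous T μ α' α ∧
    ∀ h : H, ∀ᵐ z ∂μ, {g : G | α' g z = h}.encard ≤ (C : ℕ∞)

/-- `α` is a measurable embedding. -/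
def IsMeasurableEmbedding [MeasurableSpace G] [MeasurableSpace H]
    (T : G → Z → Z) (μ : Measure Z) (α : G → Z → H) : Prop :=
  ∃ C : ℕ, IsMeasurableEmbeddingWith C T μ α

end MeasurableEmbeddings

section Couplings

/-- A measure coupling `(Ω, m)` of `G` and `H`, together with a fundamental domain `X` for the
action of `H` and a fundamental domain `Y` for the action of `G`, both of finite measure. -/
structure IsMECoupling (G H : Type*) {Ω : Type*} [Group G] [Group H] [MeasurableSpace Ω]
    [MulAction G Ω] [MulAction H Ω] (m : Measure Ω) (X Y : Set Ω) : Prop where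
  ne_zero : m ≠ 0
  sigmaFinite : SigmaFinite m
  smul_comm : ∀ (g : G) (h : H) (ω : Ω), g • h • ω = h • g • ω
  measurePreserving_left : ∀ g : G, MeasurePreserving (fun ω : Ω => g • ω) m m
  measurePreserving_right : ∀ h : H, MeasurePreserving (fun ω : Ω => h • ω) m m
  measurableSet_X : MeasurableSet X
  measurableSet_Y : MeasurableSet Y
  isFundamentalDomain_X : IsFundamentalDomain H X m
  isFundamentalDomain_Y : IsFundamentalDomain G Y m
  measure_X_lt_top : m X < ⊤
  measure_Y_lt_top : m Y < ⊤

/-- `m` is ergodic for the action of `G × H` given by the commuting actions of `G` and `H`: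
every measurable set that is invariant under `G` and under `H` is null or conull. -/
def IsJointlyErgodic (G H : Type*) {Ω : Type*} [MeasurableSpace Ω] [SMul G Ω] [SMul H Ω]
    (m : Measure Ω) : Prop :=
  ∀ A : Set Ω, MeasurableSet A → (∀ g : G, (fun ω => g • ω) ⁻¹' A = A) →
    (∀ h : H, (fun ω => h • ω) ⁻¹' A = A) → m A = 0 ∨ m Aᶜ = 0

variable {G Ω : Type*} (H : Type*) [Group H] [SMul G Ω] [SMul H Ω]

open Classical in
/-- The cocycle `α : G × X → H` of a fundamental domain `X` for `H`: the unique `α(g, x)` with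
`g • x ∈ α(g, x)⁻¹ • X`. It is defined on all of `Ω`, and its values matter only at almost every
point of `X`; where there is no unique such element the value is `1`. -/
noncomputable def couplingCocycle (X : Set Ω) (g : G) (x : Ω) : H :=
  if hx : ∃! k : H, k • g • x ∈ X then hx.choose else 1

/-- The induced action `T` of `G` on `X`, defined by `g • x = α(g, x)⁻¹ • T g x`. -/
noncomputable def couplingAction (X : Set Ω) (g : G) (x : Ω) : Ω :=
  couplingCocycle H X g x • g • x

end Couplings

/-! Replacing `X` by another fundamental domain `A` for `H` changes `α` by a coboundary, and the
fibres of the new cocycle embed in the sets `{g | g • ω ∈ A}`. So it suffices to find an `H`-domain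
`A` meeting every `G`-orbit at most `C` times, where `m X ≤ C * m Y`.

Such an `A` is built greedily (`exists_isPartialDomain_maximal`): a point is left off the
`H`-saturation of `A` only if its `G`-orbit already meets `A` in `C` points. By ergodicity, either
the saturation is conull, or almost every `G`-orbit leaves it and so has count `C`. In the second
case `m A = C * m Y ≥ m X`; as `A` meets each `H`-orbit at most once, `m A` is also the measure of
the part of `X` in the saturation, which is therefore conull after all
(`IsPartialDomain.ae_exists_smul_mem`). -/

open scoped Pointwise

/-! ### Almost everywhere uniqueness for fundamental domains -/

section FundamentalDomains

variable {G H Ω : Type*} [Group G] [Group H] [MeasurableSpace Ω] [MulAction G Ω] [MulAction H Ω]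
  {m : Measure Ω} {X : Set Ω}

theorem MeasureTheory.IsFundamentalDomain.ae_existsUnique_smul_mem [Countable H]
    [MeasurableConstSMul H Ω] [SMulInvariantMeasure H Ω m] (hX : IsFundamentalDomain H X m) :
    ∀ᵐ ω ∂m, ∃! k : H, k • ω ∈ X := by
  have hdisj : ∀ᵐ ω ∂m, ∀ k l : H, k ≠ l → ¬ (k • ω ∈ X ∧ l • ω ∈ X) := by
    rw [ae_all_iff]; intro k
    rw [ae_all_iff]; intro l
    by_cases hkl : k = l
    · simp [hkl]
    · have h0 : m (k⁻¹ • X ∩ l⁻¹ • X) = 0 := hX.aedisjoint (by simpa using hkl)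
      filter_upwards [measure_eq_zero_iff_ae_notMem.1 h0] with ω hω _
      simpa [Set.mem_inv_smul_set_iff] using hω
  filter_upwards [hX.ae_covers, hdisj] with ω ⟨k, hk⟩ hd
  exact ⟨k, hk, fun l hl => by_contra fun hne => hd l k hne ⟨hl, hk⟩⟩

theorem MeasurePreserving.ae_smul {p : Ω → Prop} [MeasurableConstSMul G Ω]
    [SMulInvariantMeasure G Ω m] (hp : ∀ᵐ ω ∂m, p ω) (g : G) : ∀ᵐ ω ∂m, p (g • ω) :=
  (measurePreserving_smul g m).quasiMeasurePreserving.ae hp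

theorem measurable_smul_of_countable [Countable H] [MeasurableSpace H] [DiscreteMeasurableSpace H]
    [MeasurableConstSMul H Ω] : Measurable fun p : H × Ω => p.1 • p.2 :=
  measurable_from_prod_countable_right fun h => measurable_const_smul h

end FundamentalDomains

/-! ### The coupling cocycle and the induced action -/

section CouplingCocycle

variable {G H Ω : Type*} [Group G] [Group H] [MulAction G Ω] [MulAction H Ω] {X : Set Ω}

theorem couplingCocycle_smul_smul_mem {g : G} {ω : Ω} (h : ∃! k : H, k • g • ω ∈ X) :
    couplingCocycle H X g ω • g • ω ∈ X := by
  rw [couplingCocycle, dif_pos h]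
  exact h.choose_spec.1

theorem couplingCocycle_eq {g : G} {ω : Ω} (h : ∃! k : H, k • g • ω ∈ X) {k : H}
    (hk : k • g • ω ∈ X) : couplingCocycle H X g ω = k :=
  h.unique (couplingCocycle_smul_smul_mem h) hk

theorem existsUnique_smul_smul_mem {ω : Ω} (h : ∃! k : H, k • ω ∈ X) (l : H) :
    ∃! k : H, k • l • ω ∈ X := by
  obtain ⟨k, hk, hu⟩ := h
  refine ⟨k * l⁻¹, by simpa [mul_smul] using hk, fun k' hk' => ?_⟩
  rw [← hu (k' * l) (by simpa [mul_smul] using hk'), mul_inv_cancel_right]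

variable [MeasurableSpace Ω] {m : Measure Ω} [Countable H] [MeasurableConstSMul H Ω]
  [MeasurableConstSMul G Ω]

theorem measurable_couplingCocycle [MeasurableSpace H] (hX : MeasurableSet X) (g : G) :
    Measurable (couplingCocycle H X g : Ω → H) := by
  have hm : ∀ k : H, MeasurableSet {ω : Ω | k • g • ω ∈ X} := fun k =>
    (measurable_const_smul k).comp (measurable_const_smul g) hX
  have hu : MeasurableSet {ω : Ω | ∃! k : H, k • g • ω ∈ X} := by
    rw [show {ω : Ω | ∃! k : H, k • g • ω ∈ X} = ⋃ k : H, {ω : Ω | k • g • ω ∈ X} ∩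
      {ω : Ω | ∀ l : H, l • g • ω ∈ X → l = k} by ext; simp [ExistsUnique]]
    refine MeasurableSet.iUnion fun k => (hm k).inter ?_
    rw [show {ω : Ω | ∀ l : H, l • g • ω ∈ X → l = k}
      = ⋂ l : H, {ω : Ω | l • g • ω ∈ X → l = k} by ext; simp]
    refine MeasurableSet.iInter fun l => ?_
    by_cases hl : l = k
    · simp [hl]
    · simp only [hl, imp_false]
      exact (hm l).compl
  refine measurable_to_countable' fun k => ?_
  -- The second piece accounts for the default value `1`.
  have : couplingCocycle H X g ⁻¹' {k} =
      {ω : Ω | ∃! k : H, k • g • ω ∈ X} ∩ {ω : Ω | k • g • ω ∈ X} ∪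
        {ω : Ω | ∃! k : H, k • g • ω ∈ X}ᶜ ∩ {_ω | k = 1} := by
    ext ω
    by_cases h : ∃! k : H, k • g • ω ∈ X
    · simp only [Set.mem_preimage, Set.mem_singleton_iff, Set.mem_union, Set.mem_inter_iff,
        Set.mem_ofPred_eq, h, true_and, Set.mem_compl_iff, not_true, false_and, or_false]
      exact ⟨fun e => e ▸ couplingCocycle_smul_smul_mem h, couplingCocycle_eq h⟩
    · simp only [Set.mem_preimage, Set.mem_singleton_iff, Set.mem_union, Set.mem_inter_iff,
        Set.mem_ofPred_eq, h, false_and, Set.mem_compl_iff, not_false_eq_true, true_and, false_or]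
      rw [couplingCocycle, dif_neg h, eq_comm]
  rw [this]
  exact (hu.inter (hm k)).union (hu.compl.inter (MeasurableSet.const _))

variable [MeasurableSpace H] [DiscreteMeasurableSpace H]

theorem measurable_couplingAction (hX : MeasurableSet X) (g : G) :
    Measurable (couplingAction H X g : Ω → Ω) :=
  measurable_smul_of_countable.comp
    ((measurable_couplingCocycle hX g).prodMk (measurable_const_smul g))

variable [SMulCommClass G H Ω] [SMulInvariantMeasure G Ω m] [SMulInvariantMeasure H Ω m]

omit [MeasurableSpace H] [DiscreteMeasurableSpace H] in
theorem couplingCocycle_mul_ae (hX : IsFundamentalDomain H X m) (g₂ g₁ : G) :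
    ∀ᵐ ω ∂m, (couplingCocycle H X (g₂ * g₁) ω : H) =
      couplingCocycle H X g₂ (couplingAction H X g₁ ω) * couplingCocycle H X g₁ ω := by
  have hu := hX.ae_existsUnique_smul_mem
  filter_upwards [MeasurePreserving.ae_smul hu (g₂ * g₁)] with ω h₂₁
  refine couplingCocycle_eq h₂₁ ?_
  -- The actions commute, so this point is in the `H`-orbit of `(g₂ * g₁) • ω`, even if the cocycle
  -- at `g₁` took its default value.
  have h₂ : ∃! k : H, k • g₂ • couplingAction H X g₁ ω ∈ X := by
    rw [couplingAction, smul_comm g₂, ← mul_smul g₂ g₁]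
    exact existsUnique_smul_smul_mem h₂₁ _
  have := couplingCocycle_smul_smul_mem h₂
  rwa [couplingAction, smul_comm g₂, ← mul_smul g₂ g₁, ← mul_smul] at this

omit [MeasurableSpace H] [DiscreteMeasurableSpace H] in
theorem couplingAction_mul_ae (hX : IsFundamentalDomain H X m) (g₂ g₁ : G) :
    ∀ᵐ ω ∂m, couplingAction H X (g₂ * g₁) ω =
      couplingAction H X g₂ (couplingAction H X g₁ ω) := by
  filter_upwards [couplingCocycle_mul_ae (H := H) hX g₂ g₁] with ω h
  rw [couplingAction, h]
  simp only [couplingAction, mul_smul, smul_comm g₂]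

/-- Up to null sets, pulling back `E` inside `X` amounts to pulling back the `H`-saturation `S` of
`E ∩ X` by `g`. Since `g • X` is again an `H`-domain, the invariant set `S` has the same measure in
`g • X` as in `X`. -/
theorem measurePreserving_couplingAction (hXm : MeasurableSet X) (hX : IsFundamentalDomain H X m)
    (g : G) : MeasurePreserving (couplingAction H X g) (m.restrict X) (m.restrict X) := by
  have hmeas := measurable_couplingAction (H := H) hXm g
  refine ⟨hmeas, Measure.ext fun E hE => ?_⟩
  rw [Measure.map_apply hmeas hE, Measure.restrict_apply (hmeas hE), Measure.restrict_apply hE]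
  have hu := hX.ae_existsUnique_smul_mem
  have hEX := hE.inter hXm
  set S : Set Ω := ⋃ k : H, (fun ω => k • ω) ⁻¹' (E ∩ X) with hS
  have hSm : MeasurableSet S := MeasurableSet.iUnion fun k => measurable_const_smul k hEX
  have hSinv : ∀ k : H, (fun ω => k • ω) ⁻¹' S = S := by
    intro k
    ext ω
    simp only [hS, Set.mem_preimage, Set.mem_iUnion, ← mul_smul]
    exact ⟨fun ⟨l, hl⟩ => ⟨l * k, hl⟩, fun ⟨l, hl⟩ => ⟨l * k⁻¹, by simpa using hl⟩⟩
  have hgS : m (couplingAction H X g ⁻¹' E ∩ X) = m ((fun ω => g • ω) ⁻¹' S ∩ X) := by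
    refine measure_congr ?_
    filter_upwards [MeasurePreserving.ae_smul hu g] with ω h
    have hmem := couplingCocycle_smul_smul_mem h
    refine propext (and_congr_left fun _ => ?_)
    simp only [hS, Set.mem_preimage, Set.mem_iUnion]
    refine ⟨fun hω => ⟨couplingCocycle H X g ω, hω, hmem⟩, fun ⟨k, hk⟩ => ?_⟩
    rw [couplingAction, couplingCocycle_eq h hk.2]
    exact hk.1
  have hSX : m (S ∩ X) = m (E ∩ X) := by
    refine measure_congr ?_
    filter_upwards [hu] with ω h
    change (ω ∈ S ∩ X) = (ω ∈ E ∩ X)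
    refine propext ⟨fun ⟨hω, hx⟩ => ?_, fun hω => ⟨Set.mem_iUnion.2 ⟨1, by simpa using hω⟩, hω.2⟩⟩
    obtain ⟨k, hk⟩ := Set.mem_iUnion.1 hω
    have hk1 : k = 1 := h.unique hk.2 (by simpa using hx)
    simpa [hk1] using hk
  have hgX : m ((fun ω => g • ω) ⁻¹' S ∩ X) = m (S ∩ g • X) := by
    rw [← measure_smul (μ := m) g ((fun ω => g • ω) ⁻¹' S ∩ X), Set.smul_set_inter,
      Set.preimage_smul, smul_inv_smul]
  rw [hgS, hgX, ← hSX]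
  exact (hX.smul_of_comm g).measure_set_eq hX hSm hSinv

theorem isFMPAction_couplingAction (hXm : MeasurableSet X) (hX : IsFundamentalDomain H X m)
    (hfin : m X < ⊤) : IsFMPAction (G := G) (couplingAction H X) (m.restrict X) where
  isFiniteMeasure := ⟨by simpa using hfin⟩
  measurePreserving := measurePreserving_couplingAction hXm hX
  one_ae := by
    filter_upwards [ae_restrict_of_ae (MeasurePreserving.ae_smul hX.ae_existsUnique_smul_mem (1 : G)),
      ae_restrict_mem hXm] with ω h hω
    rw [couplingAction, couplingCocycle_eq h (k := 1) (by simpa using hω), one_smul, one_smul]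
  mul_ae g₁ g₂ := ae_restrict_of_ae (couplingAction_mul_ae hX g₁ g₂)

variable [Countable G] [MeasurableSpace G] [DiscreteMeasurableSpace G]

omit [DiscreteMeasurableSpace H] in
theorem isMeasurableCocycle_couplingCocycle (hXm : MeasurableSet X)
    (hX : IsFundamentalDomain H X m) :
    IsMeasurableCocycle (G := G) (couplingAction H X) (m.restrict X) (couplingCocycle H X) where
  measurable := measurable_from_prod_countable_right fun g => measurable_couplingCocycle hXm g
  mul_ae g₂ g₁ := ae_restrict_of_ae (couplingCocycle_mul_ae hX g₂ g₁)

end CouplingCocycle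

theorem IsMeasurableCocycle.transfer {G H Z : Type*} [Group G] [Countable G] [Group H] [Countable H]
    [MeasurableSpace Z] [MeasurableSpace G] [DiscreteMeasurableSpace G] [MeasurableSpace H]
    [DiscreteMeasurableSpace H] {T : G → Z → Z} {μ : Measure Z} {α : G → Z → H} {φ : Z → H}
    (hα : IsMeasurableCocycle T μ α) (hT : IsFMPAction T μ) (hφ : Measurable φ) :
    IsMeasurableCocycle T μ fun g z => φ (T g z) * α g z * (φ z)⁻¹ where
  measurable := measurable_from_prod_countable_right fun g =>
    ((hφ.comp (hT.measurePreserving g).measurable).mul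
      (hα.measurable.comp measurable_prodMk_left)).mul hφ.inv
  mul_ae g₂ g₁ := by
    filter_upwards [hα.mul_ae g₂ g₁, hT.mul_ae g₂ g₁] with z h₁ h₂
    rw [h₁, h₂]
    group

/-! ### Greedy construction of a maximal partial domain -/

section GreedyDomain

variable {G H Ω : Type*} [Group G] [Group H] [MulAction G Ω] [MulAction H Ω]

theorem encard_setOf_smul_smul_mem (A : Set Ω) (g₀ : G) (ω : Ω) :
    {g : G | g • g₀ • ω ∈ A}.encard = {g : G | g • ω ∈ A}.encard := by
  rw [← Set.encard_preimage_of_bijective (Group.mulRight_bijective g₀) {g : G | g • ω ∈ A}]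
  simp only [Set.preimage_ofPred_eq, mul_smul]

theorem Set.encard_iUnion_le_of_monotone {γ : Type*} {s : ℕ → Set γ} (hs : Monotone s) {C : ℕ}
    (h : ∀ n, (s n).encard ≤ C) : (⋃ n, s n).encard ≤ C := by
  by_contra! hlt
  obtain ⟨t, hts, ht⟩ := Set.exists_subset_encard_eq (k := (C : ℕ∞) + 1)
    (Order.add_one_le_of_lt hlt)
  have hfin : t.Finite := Set.finite_of_encard_eq_coe (k := C + 1) (by simpa using ht)
  have hev : ∀ᶠ n in Filter.atTop, ∀ x ∈ t, x ∈ s n := by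
    rw [Filter.eventually_all_finite hfin]
    intro x hx
    obtain ⟨n, hn⟩ := Set.mem_iUnion.1 (hts hx)
    exact Filter.eventually_atTop.2 ⟨n, fun k hk => hs hk hn⟩
  obtain ⟨n, hn⟩ := hev.exists
  have hle := (Set.encard_le_encard hn).trans (h n)
  rw [ht] at hle
  exact absurd hle (by exact_mod_cast Nat.not_succ_le_self C)

theorem coe_encard_setOf_smul_mem (A : Set Ω) (ω : Ω) :
    (({g : G | g • ω ∈ A}.encard : ℕ∞) : ENNReal) =
      ∑' g : G, A.indicator (1 : Ω → ENNReal) (g • ω) := by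
  rw [← ENNReal.tsum_set_one, tsum_subtype {g : G | g • ω ∈ A} (fun _ => (1 : ENNReal))]
  rfl

variable [MeasurableSpace Ω]

theorem measurable_coe_encard_setOf_smul_mem [Countable G] [MeasurableConstSMul G Ω] {A : Set Ω}
    (hA : MeasurableSet A) :
    Measurable fun ω : Ω => (({g : G | g • ω ∈ A}.encard : ℕ∞) : ENNReal) := by
  simp only [coe_encard_setOf_smul_mem]
  exact Measurable.tsum fun g =>
    (measurable_one.indicator hA).comp (measurable_const_smul g)

theorem measurableSet_encard_setOf_smul_mem_lt [Countable G] [MeasurableConstSMul G Ω] {A : Set Ω}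
    (hA : MeasurableSet A) (C : ℕ) :
    MeasurableSet {ω : Ω | {g : G | g • ω ∈ A}.encard < (C : ℕ∞)} := by
  convert measurableSet_lt (measurable_coe_encard_setOf_smul_mem (G := G) hA)
    (measurable_const (a := ((C : ℕ∞) : ENNReal))) using 3
  rw [ENat.toENNReal_lt]

theorem measurableSet_exists_smul_mem [Countable H] [MeasurableConstSMul H Ω] {A : Set Ω}
    (hA : MeasurableSet A) : MeasurableSet {ω : Ω | ∃ h : H, h • ω ∈ A} := by
  rw [Set.ofPred_exists]
  exact MeasurableSet.iUnion fun h => measurable_const_smul h hA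

variable (G H) in
/-- `A` is measurable, meets every `H`-orbit at most once and, counting with stabilizers, meets
every `G`-orbit at most `C` times. -/
structure IsPartialDomain (C : ℕ) (A : Set Ω) : Prop where
  measurableSet : MeasurableSet A
  subsingleton : ∀ ω, {h : H | h • ω ∈ A}.Subsingleton
  encard_le : ∀ ω, {g : G | g • ω ∈ A}.encard ≤ (C : ℕ∞)

variable (G H) in
/-- One greedy step: add to `A` the points of `p.1⁻¹ • Y ∩ p.2⁻¹ • X` which lie off the
`H`-saturation of `A` and whose `G`-orbit meets `A` fewer than `C` times. -/
def greedyStep (C : ℕ) (X Y A : Set Ω) (p : G × H) : Set Ω :=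
  A ∪ {ω | (p.1 • ω ∈ Y ∧ p.2 • ω ∈ X) ∧
    (¬ ∃ h : H, h • ω ∈ A) ∧ {g : G | g • ω ∈ A}.encard < (C : ℕ∞)}

/-- The new points lie in one translate of `Y` and one of `X`, so each `G`-orbit count grows by at
most one, and only where it was below `C`; no `H`-orbit gains two points. -/
theorem IsPartialDomain.greedyStep [Countable G] [Countable H] [MeasurableConstSMul G Ω]
    [MeasurableConstSMul H Ω] {C : ℕ} {X Y A : Set Ω} (hA : IsPartialDomain G H C A)
    (hXm : MeasurableSet X) (hYm : MeasurableSet Y)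
    (hX : ∀ ω, {h : H | h • ω ∈ X}.Subsingleton) (hY : ∀ ω, {g : G | g • ω ∈ Y}.Subsingleton)
    (p : G × H) : IsPartialDomain G H C (greedyStep G H C X Y A p) where
  measurableSet := hA.measurableSet.union
    (((measurable_const_smul p.1 hYm).inter (measurable_const_smul p.2 hXm)).inter
      ((measurableSet_exists_smul_mem hA.measurableSet).compl.inter
        (measurableSet_encard_setOf_smul_mem_lt hA.measurableSet C)))
  subsingleton ω h₁ hh₁ h₂ hh₂ := by
    have key : ∀ h₁ h₂ : H, h₁ • ω ∈ A →
        (¬ ∃ h : H, h • h₂ • ω ∈ A) → False := fun h₁ h₂ hm hn =>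
      hn ⟨h₁ * h₂⁻¹, by simpa [mul_smul] using hm⟩
    rcases hh₁ with hh₁ | ⟨⟨-, hx₁⟩, hn₁, -⟩ <;> rcases hh₂ with hh₂ | ⟨⟨-, hx₂⟩, hn₂, -⟩
    · exact hA.subsingleton ω hh₁ hh₂
    · exact (key h₁ h₂ hh₁ hn₂).elim
    · exact (key h₂ h₁ hh₂ hn₁).elim
    · rw [← mul_smul] at hx₁ hx₂
      exact mul_left_cancel (hX ω hx₁ hx₂)
  encard_le ω := by
    set Z : Set Ω := {ω | (p.1 • ω ∈ Y ∧ p.2 • ω ∈ X) ∧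
      (¬ ∃ h : H, h • ω ∈ A) ∧ {g : G | g • ω ∈ A}.encard < (C : ℕ∞)} with hZ
    change ({g : G | g • ω ∈ A} ∪ {g : G | g • ω ∈ Z}).encard ≤ _
    rcases {g : G | g • ω ∈ Z}.eq_empty_or_nonempty with h0 | ⟨g₀, hg₀⟩
    · rw [h0, Set.union_empty]
      exact hA.encard_le ω
    · have hsub : {g : G | g • ω ∈ Z}.Subsingleton := by
        intro g₁ h₁ g₂ h₂
        have h₁' := h₁.1.1
        have h₂' := h₂.1.1
        rw [← mul_smul] at h₁' h₂'
        exact mul_left_cancel (hY ω h₁' h₂')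
      have hlt := hg₀.2.2
      rw [encard_setOf_smul_smul_mem] at hlt
      calc _ ≤ _ := Set.encard_union_le _ _
        _ ≤ {g : G | g • ω ∈ A}.encard + 1 := by
          gcongr
          exact Set.encard_le_one_iff_subsingleton.2 hsub
        _ ≤ C := Order.add_one_le_of_lt hlt

theorem exists_isPartialDomain_maximal [Countable G] [Countable H] [MeasurableConstSMul G Ω]
    [MeasurableConstSMul H Ω] (C : ℕ) {X Y : Set Ω} (hXm : MeasurableSet X) (hYm : MeasurableSet Y)
    (hX : ∀ ω, {h : H | h • ω ∈ X}.Subsingleton) (hY : ∀ ω, {g : G | g • ω ∈ Y}.Subsingleton) :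
    ∃ A : Set Ω, IsPartialDomain G H C A ∧ ∀ ω, (∃ g : G, g • ω ∈ Y) → (∃ h : H, h • ω ∈ X) →
      (∃ h : H, h • ω ∈ A) ∨ (C : ℕ∞) ≤ {g : G | g • ω ∈ A}.encard := by
  obtain ⟨e, he⟩ := exists_surjective_nat (G × H)
  let A : ℕ → Set Ω := fun n => Nat.rec ∅ (fun n B => greedyStep G H C X Y B (e n)) n
  have hA : ∀ n, IsPartialDomain G H C (A n) := by
    intro n
    induction n with
    | zero => exact ⟨MeasurableSet.empty, fun ω => by simp [A], fun ω => by simp [A]⟩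
    | succ n ih => exact ih.greedyStep hXm hYm hX hY (e n)
  have hmono : Monotone A := monotone_nat_of_le_succ fun n => Set.subset_union_left
  refine ⟨⋃ n, A n, ⟨MeasurableSet.iUnion fun n => (hA n).measurableSet, ?_, ?_⟩, ?_⟩
  · intro ω h₁ hh₁ h₂ hh₂
    obtain ⟨n₁, hn₁⟩ := Set.mem_iUnion.1 hh₁
    obtain ⟨n₂, hn₂⟩ := Set.mem_iUnion.1 hh₂
    exact (hA (max n₁ n₂)).subsingleton ω (hmono (le_max_left _ _) hn₁)
      (hmono (le_max_right _ _) hn₂)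
  · intro ω
    rw [show {g : G | g • ω ∈ ⋃ n, A n} = ⋃ n, {g : G | g • ω ∈ A n} by ext; simp]
    exact Set.encard_iUnion_le_of_monotone (s := fun n => {g : G | g • ω ∈ A n})
      (fun i j hij g hg => hmono hij hg) fun n => (hA n).encard_le ω
  · rintro ω ⟨g, hg⟩ ⟨h, hh⟩
    by_contra! hcon
    obtain ⟨hno, hlt⟩ := hcon
    obtain ⟨n, hn⟩ := he (g, h)
    -- One visit to each pair is enough: both obstructions to adding `ω` only grow with the stage,
    -- so their absence in the union gives their absence at stage `n`.
    have hmem : ω ∈ A (n + 1) := by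
      refine Or.inr ⟨by rw [hn]; exact ⟨hg, hh⟩, ?_, ?_⟩
      · rintro ⟨k, hk⟩
        exact hno k (Set.mem_iUnion.2 ⟨n, hk⟩)
      · refine lt_of_le_of_lt (Set.encard_le_encard ?_) hlt
        exact fun g hg => Set.mem_iUnion.2 ⟨n, hg⟩
    exact hno 1 (by rw [one_smul]; exact Set.mem_iUnion.2 ⟨n + 1, hmem⟩)

end GreedyDomain

/-! ### From maximality and ergodicity to a full domain -/

section Domains

variable {G H Ω : Type*} [Group G] [Group H] [MeasurableSpace Ω] [MulAction G Ω] [MulAction H Ω]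
  {m : Measure Ω} {X Y : Set Ω}

/-- Makes uniqueness hold at every point, so that the greedy construction involves no null sets. -/
theorem MeasureTheory.IsFundamentalDomain.exists_subset_subsingleton [Countable H]
    [MeasurableConstSMul H Ω] [SMulInvariantMeasure H Ω m] (hX : IsFundamentalDomain H X m)
    (hXm : MeasurableSet X) : ∃ X₀ : Set Ω, MeasurableSet X₀ ∧
      (∀ ω, {h : H | h • ω ∈ X₀}.Subsingleton) ∧ ∀ᵐ ω ∂m, ∃ h : H, h • ω ∈ X₀ := by
  refine ⟨{ω | ω ∈ X ∧ ∀ h : H, h • ω ∈ X → h = 1}, ?_, ?_, ?_⟩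
  · refine hXm.inter (s₂ := {ω : Ω | ∀ h : H, h • ω ∈ X → h = 1}) ?_
    rw [show {ω : Ω | ∀ h : H, h • ω ∈ X → h = 1} = ⋂ h : H, {ω : Ω | h • ω ∈ X → h = 1} by
      ext; simp]
    refine MeasurableSet.iInter fun h => ?_
    by_cases hh : h = 1
    · simp [hh]
    · simp only [hh, imp_false]
      exact (measurable_const_smul h hXm).compl
  · intro ω h₁ hh₁ h₂ hh₂
    have := hh₁.2 (h₂ * h₁⁻¹) (by simpa [mul_smul] using hh₂.1)
    exact (mul_inv_eq_one.1 this).symm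
  · filter_upwards [hX.ae_existsUnique_smul_mem] with ω h
    obtain ⟨k, hk, hu⟩ := h
    refine ⟨k, hk, fun h hh => ?_⟩
    rw [← mul_smul] at hh
    exact mul_eq_right.1 (hu _ hh)

theorem MeasureTheory.IsFundamentalDomain.measure_eq_lintegral_encard [Countable G]
    [MeasurableConstSMul G Ω] [SMulInvariantMeasure G Ω m] (hY : IsFundamentalDomain G Y m)
    {A : Set Ω} (hA : MeasurableSet A) :
    m A = ∫⁻ ω in Y, (({g : G | g • ω ∈ A}.encard : ℕ∞) : ENNReal) ∂m := by
  simp only [coe_encard_setOf_smul_mem]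
  have hind : ∀ g : G, (fun ω : Ω => A.indicator (1 : Ω → ENNReal) (g • ω)) =
      ((fun ω => g • ω) ⁻¹' A).indicator 1 := fun g => rfl
  -- The decomposition over `Y` uses the translates `g • A`, the orbit count uses `g⁻¹ • A`; hence
  -- the reindexing by inversion.
  rw [lintegral_tsum fun g => by
      rw [hind]; exact (measurable_one.indicator (measurable_const_smul g hA)).aemeasurable,
    hY.measure_eq_tsum A, ← Equiv.tsum_eq (Equiv.inv G)]
  refine tsum_congr fun g => ?_
  rw [hind, lintegral_indicator_one (measurable_const_smul g hA),
    Measure.restrict_apply (measurable_const_smul g hA), Set.preimage_smul]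
  rfl

variable [Countable G] [Countable H] [MeasurableConstSMul G Ω] [MeasurableConstSMul H Ω]
  [SMulCommClass G H Ω] [SMulInvariantMeasure G Ω m] [SMulInvariantMeasure H Ω m]

omit [SMulCommClass G H Ω] in
/-- A partial domain whose `G`-orbit counts are almost everywhere maximal is a domain for `H`. -/
theorem IsPartialDomain.ae_exists_smul_mem {C : ℕ} {A : Set Ω} (hA : IsPartialDomain G H C A)
    (hX : IsFundamentalDomain H X m) (hY : IsFundamentalDomain G Y m) (hfin : m X ≠ ⊤)
    (hC : m X ≤ C * m Y) (hfull : ∀ᵐ ω ∂m, (C : ℕ∞) ≤ {g : G | g • ω ∈ A}.encard) :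
    ∀ᵐ ω ∂m, ∃ h : H, h • ω ∈ A := by
  have hSm := measurableSet_exists_smul_mem (H := H) hA.measurableSet
  set S : Set Ω := {ω : Ω | ∃ h : H, h • ω ∈ A} with hS
  -- `m A` is computed twice, by integrating `G`-orbit counts over `Y` and `H`-orbit counts over
  -- `X`.
  have hle : m X ≤ m (S ∩ X) := by
    calc m X ≤ C * m Y := hC
      _ = ∫⁻ _ in Y, ((C : ℕ∞) : ENNReal) ∂m := by simp
      _ ≤ ∫⁻ ω in Y, (({g : G | g • ω ∈ A}.encard : ℕ∞) : ENNReal) ∂m := by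
        refine lintegral_mono_ae ?_
        filter_upwards [ae_restrict_of_ae hfull] with ω h
        exact ENat.toENNReal_le.2 h
      _ = m A := (hY.measure_eq_lintegral_encard hA.measurableSet).symm
      _ = ∫⁻ ω in X, (({h : H | h • ω ∈ A}.encard : ℕ∞) : ENNReal) ∂m :=
        hX.measure_eq_lintegral_encard hA.measurableSet
      _ ≤ ∫⁻ ω in X, S.indicator 1 ω ∂m := by
        refine lintegral_mono fun ω => ?_
        by_cases hω : ω ∈ S
        · rw [Set.indicator_of_mem hω, Pi.one_apply, ← ENat.toENNReal_one]
          exact ENat.toENNReal_le.2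
            (Set.encard_le_one_iff_subsingleton.2 (hA.subsingleton ω))
        · have : {h : H | h • ω ∈ A} = ∅ := by
            ext h
            exact ⟨fun hh => hω ⟨h, hh⟩, fun hh => hh.elim⟩
          simp [this]
      _ = m (S ∩ X) := by rw [lintegral_indicator_one hSm, Measure.restrict_apply hSm]
  have hinv : ∀ h : H, h • Sᶜ = Sᶜ := by
    intro h
    rw [Set.smul_set_compl]
    congr 1
    ext ω
    rw [Set.mem_smul_set_iff_inv_smul_mem]
    simp only [hS, Set.mem_ofPred_eq, ← mul_smul]
    exact ⟨fun ⟨l, hl⟩ => ⟨l * h⁻¹, hl⟩, fun ⟨l, hl⟩ => ⟨l * h, by simpa using hl⟩⟩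
  have h0 : m (Sᶜ ∩ X) = 0 := by
    have hadd := measure_inter_add_sdiff₀ (μ := m) X hSm.nullMeasurableSet
    rw [Set.inter_comm X S] at hadd
    have hle' : m (S ∩ X) + m (X \ S) ≤ m (S ∩ X) + 0 := by rw [hadd, add_zero]; exact hle
    have := (ENNReal.add_le_add_iff_left (measure_ne_top_of_subset Set.inter_subset_right hfin)).1
      hle'
    rw [Set.inter_comm, ← Set.sdiff_eq]
    exact le_antisymm this zero_le
  exact hX.measure_zero_of_invariant Sᶜ hinv h0

theorem exists_isPartialDomain_ae_exists_smul_mem (hXm : MeasurableSet X) (hYm : MeasurableSet Y)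
    (hX : IsFundamentalDomain H X m) (hY : IsFundamentalDomain G Y m) (hfin : m X ≠ ⊤)
    (herg : IsJointlyErgodic G H m) {C : ℕ} (hC : m X ≤ C * m Y) :
    ∃ A : Set Ω, IsPartialDomain G H C A ∧ ∀ᵐ ω ∂m, ∃ h : H, h • ω ∈ A := by
  obtain ⟨X₀, hX₀m, hX₀, hXcov⟩ := hX.exists_subset_subsingleton hXm
  obtain ⟨Y₀, hY₀m, hY₀, hYcov⟩ := hY.exists_subset_subsingleton hYm
  obtain ⟨A, hA, hmax⟩ := exists_isPartialDomain_maximal (G := G) (H := H) C hX₀m hY₀m hX₀ hY₀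
  refine ⟨A, hA, ?_⟩
  have hor : ∀ᵐ ω ∂m, ∀ g : G,
      (∃ h : H, h • g • ω ∈ A) ∨ (C : ℕ∞) ≤ {g' : G | g' • g • ω ∈ A}.encard := by
    rw [ae_all_iff]
    intro g
    have hor₁ : ∀ᵐ ω ∂m, (∃ h : H, h • ω ∈ A) ∨ (C : ℕ∞) ≤ {g' : G | g' • ω ∈ A}.encard := by
      filter_upwards [hXcov, hYcov] with ω hx hy using hmax ω hy hx
    exact MeasurePreserving.ae_smul hor₁ g
  -- The points whose `G`-orbit leaves the `H`-saturation of `A`: an invariant set to which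
  -- ergodicity applies.
  have hSm : MeasurableSet {ω : Ω | ∃ g : G, ¬ ∃ h : H, h • g • ω ∈ A} :=
    measurableSet_exists_smul_mem (measurableSet_exists_smul_mem hA.measurableSet).compl
  have hSG : ∀ g : G, (fun ω => g • ω) ⁻¹' {ω : Ω | ∃ g : G, ¬ ∃ h : H, h • g • ω ∈ A} =
      {ω : Ω | ∃ g : G, ¬ ∃ h : H, h • g • ω ∈ A} := by
    intro g
    ext ω
    simp only [Set.mem_preimage, Set.mem_ofPred_eq]
    constructor
    · rintro ⟨g', h⟩
      exact ⟨g' * g, by simpa only [mul_smul] using h⟩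
    · rintro ⟨g', h⟩
      exact ⟨g' * g⁻¹, by simpa only [mul_smul, inv_smul_smul] using h⟩
  have hSH : ∀ k : H, (fun ω => k • ω) ⁻¹' {ω : Ω | ∃ g : G, ¬ ∃ h : H, h • g • ω ∈ A} =
      {ω : Ω | ∃ g : G, ¬ ∃ h : H, h • g • ω ∈ A} := by
    intro k
    ext ω
    simp only [Set.mem_preimage, Set.mem_ofPred_eq]
    refine exists_congr fun g => not_congr ?_
    rw [smul_comm g k]
    constructor
    · rintro ⟨h, hh⟩
      exact ⟨h * k, by simpa only [mul_smul] using hh⟩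
    · rintro ⟨h, hh⟩
      exact ⟨h * k⁻¹, by simpa only [mul_smul, inv_smul_smul] using hh⟩
  rcases herg _ hSm hSG hSH with h0 | h0
  · filter_upwards [measure_eq_zero_iff_ae_notMem.1 h0] with ω hω
    by_contra hcon
    exact hω ⟨1, by simpa using hcon⟩
  · refine hA.ae_exists_smul_mem hX hY hfin hC ?_
    filter_upwards [measure_eq_zero_iff_ae_notMem.1 h0, hor] with ω hω hg
    obtain ⟨g, hno⟩ := not_not.1 hω
    -- Maximality gives the count at `g • ω`; counts are constant on `G`-orbits.
    rw [← encard_setOf_smul_smul_mem A g ω]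
    exact (hg g).resolve_left hno

end Domains

section CouplingSymmetry

variable {G H Ω : Type*} [Group G] [Group H] [MeasurableSpace Ω] [MulAction G Ω] [MulAction H Ω]
  {m : Measure Ω} {X Y : Set Ω}

theorem IsMECoupling.smulCommClass (hc : IsMECoupling G H m X Y) : SMulCommClass G H Ω :=
  ⟨hc.smul_comm⟩

theorem IsMECoupling.symm (hc : IsMECoupling G H m X Y) : IsMECoupling H G m Y X where
  ne_zero := hc.ne_zero
  sigmaFinite := hc.sigmaFinite
  smul_comm h g ω := (hc.smul_comm g h ω).symm
  measurePreserving_left := hc.measurePreserving_right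
  measurePreserving_right := hc.measurePreserving_left
  measurableSet_X := hc.measurableSet_Y
  measurableSet_Y := hc.measurableSet_X
  isFundamentalDomain_X := hc.isFundamentalDomain_Y
  isFundamentalDomain_Y := hc.isFundamentalDomain_X
  measure_X_lt_top := hc.measure_Y_lt_top
  measure_Y_lt_top := hc.measure_X_lt_top

theorem IsMECoupling.measureReal_pos [Countable H] (hc : IsMECoupling G H m X Y) : 0 < m.real X := by
  have : MeasurableConstSMul H Ω := ⟨fun h => (hc.measurePreserving_right h).measurable⟩
  have : SMulInvariantMeasure H Ω m :=
    ⟨fun h _ hs => (hc.measurePreserving_right h).measure_preimage hs.nullMeasurableSet⟩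
  refine ENNReal.toReal_pos (fun h0 => hc.ne_zero ?_) hc.measure_X_lt_top.ne
  exact hc.isFundamentalDomain_X.measure_ne_zero hc.ne_zero h0 |>.elim

end CouplingSymmetry

/-! ### Embeddings from domains with bounded orbit counts -/

section Embeddings

variable {G H Ω : Type*} [Group G] [Countable G] [MeasurableSpace G] [DiscreteMeasurableSpace G]
  [Group H] [Countable H] [MeasurableSpace H] [DiscreteMeasurableSpace H] [MeasurableSpace Ω]
  [MulAction G Ω] [MulAction H Ω] {m : Measure Ω} {X Y : Set Ω}

theorem isMeasurableEmbeddingWith_of_isPartialDomain [MeasurableConstSMul G Ω]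
    [MeasurableConstSMul H Ω] [SMulCommClass G H Ω] [SMulInvariantMeasure G Ω m]
    [SMulInvariantMeasure H Ω m] (hXm : MeasurableSet X) (hX : IsFundamentalDomain H X m)
    (hfin : m X < ⊤) {C : ℕ} (hC : 0 < C) {A : Set Ω} (hA : IsPartialDomain G H C A)
    (hcov : ∀ᵐ ω ∂m, ∃ h : H, h • ω ∈ A) :
    IsMeasurableEmbeddingWith (G := G) C (couplingAction H X) (m.restrict X)
      (couplingCocycle H X) := by
  have hT := isFMPAction_couplingAction (G := G) hXm hX hfin
  have hα := isMeasurableCocycle_couplingCocycle (G := G) hXm hX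
  -- At `g = 1` the cocycle of `A` is the element of `H` carrying a point into `A`: this is the
  -- transfer function `φ`.
  have hφ : Measurable (couplingCocycle H A (1 : G) : Ω → H) :=
    measurable_couplingCocycle hA.measurableSet 1
  refine ⟨hT, hα, hC, _, hα.transfer hT hφ, ⟨_, hφ, fun g => ae_of_all _ fun _ => rfl⟩, ?_⟩
  intro h
  have hall : ∀ᵐ ω ∂m, ∀ g : G, ∃ h : H, h • g • ω ∈ A :=
    ae_all_iff.2 (MeasurePreserving.ae_smul hcov)
  filter_upwards [ae_restrict_of_ae hall] with ω hω
  -- If `α' g ω = h`, then `g • h • φ ω • ω = φ (T g ω) • T g ω ∈ A`.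
  refine le_trans (Set.encard_le_encard ?_)
    (hA.encard_le (h • (couplingCocycle H A (1 : G) ω : H) • ω))
  rintro g rfl
  have hu : ∃! k : H, k • g • ω ∈ A := by
    obtain ⟨k, hk⟩ := hω g
    exact ⟨k, hk, fun l hl => hA.subsingleton _ hl hk⟩
  have hmem : couplingCocycle H A (1 : G) (couplingAction H X g ω) • couplingAction H X g ω ∈ A := by
    have := couplingCocycle_smul_smul_mem (X := A) (g := (1 : G))
      (ω := couplingAction H X g ω) (by
        rw [one_smul]
        exact existsUnique_smul_smul_mem hu _)
    rwa [one_smul] at this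
  change g • _ ∈ A
  rw [smul_comm g, smul_comm g, ← mul_smul, inv_mul_cancel_right, mul_smul]
  exact hmem

theorem IsMECoupling.isMeasurableEmbeddingWith (hc : IsMECoupling G H m X Y)
    (herg : IsJointlyErgodic G H m) :
    IsMeasurableEmbeddingWith (G := G) ⌈m.real X / m.real Y⌉₊ (couplingAction H X)
      (m.restrict X) (couplingCocycle H X) := by
  have : MeasurableConstSMul G Ω := ⟨fun g => (hc.measurePreserving_left g).measurable⟩
  have : MeasurableConstSMul H Ω := ⟨fun h => (hc.measurePreserving_right h).measurable⟩
  have : SMulInvariantMeasure G Ω m :=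
    ⟨fun g _ hs => (hc.measurePreserving_left g).measure_preimage hs.nullMeasurableSet⟩
  have : SMulInvariantMeasure H Ω m :=
    ⟨fun h _ hs => (hc.measurePreserving_right h).measure_preimage hs.nullMeasurableSet⟩
  have := hc.smulCommClass
  have hXpos := hc.measureReal_pos
  have hYpos := hc.symm.measureReal_pos
  have hC : m X ≤ (⌈m.real X / m.real Y⌉₊ : ENNReal) * m Y := by
    rw [← ENNReal.toReal_le_toReal hc.measure_X_lt_top.ne
      (ENNReal.mul_ne_top (ENNReal.natCast_ne_top _) hc.measure_Y_lt_top.ne), ENNReal.toReal_mul,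
      ENNReal.toReal_natCast]
    exact (div_le_iff₀ hYpos).1 (Nat.le_ceil _)
  obtain ⟨A, hA, hcov⟩ := exists_isPartialDomain_ae_exists_smul_mem hc.measurableSet_X
    hc.measurableSet_Y hc.isFundamentalDomain_X hc.isFundamentalDomain_Y hc.measure_X_lt_top.ne
    herg hC
  exact isMeasurableEmbeddingWith_of_isPartialDomain hc.measurableSet_X hc.isFundamentalDomain_X
    hc.measure_X_lt_top (Nat.ceil_pos.2 (div_pos hXpos hYpos)) hA hcov

end Embeddings

theorem theoremB6 {G H Ω : Type*} [Group G] [Countable G] [MeasurableSpace G]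
    [DiscreteMeasurableSpace G] [Group H] [Countable H] [MeasurableSpace H]
    [DiscreteMeasurableSpace H] [MeasurableSpace Ω] [MulAction G Ω] [MulAction H Ω]
    (m : Measure Ω) (X Y : Set Ω) (hcoupling : IsMECoupling G H m X Y)
    (hergodic : IsJointlyErgodic G H m) :
    (IsMeasurableEmbedding (G := G) (couplingAction H X) (m.restrict X) (couplingCocycle H X) ∧
      IsMeasurableEmbedding (G := H) (couplingAction G Y) (m.restrict Y) (couplingCocycle G Y)) ∧
    IsMeasurableEmbeddingWith (G := G) ⌈m.real X / m.real Y⌉₊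
      (couplingAction H X) (m.restrict X) (couplingCocycle H X) ∧
    IsMeasurableEmbeddingWith (G := H) ⌈m.real Y / m.real X⌉₊
      (couplingAction G Y) (m.restrict Y) (couplingCocycle G Y) := by
  have hα := hcoupling.isMeasurableEmbeddingWith hergodic
  have hβ := hcoupling.symm.isMeasurableEmbeddingWith
    fun A hA hH hG => hergodic A hA hG hH
  exact ⟨⟨⟨_, hα⟩, ⟨_, hβ⟩⟩, hα, hβ⟩
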